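/- For $U\in M_N(\mathbb C)$ let $\|U\|_1=\sum_{i,j}|U_{ij}|$. A matrix $H\in M_N(\mathbb C)$ is called complex almost Hadamard if $U=H/\sqrt N$ is unitary and is a local maximizer of $\|\cdot\|_1$ on $U(N)$. Given real numbers $a,b,c>0$ with $ac<b^2$, let $t$ be the smaller root of $at^2-2bt+c=0$, and put $$x=-\frac{t}{\sqrt b\,(t+1)},\qquad y=\frac{1}{\sqrt b\,(t+1)}.$$ For an incidence structure with $N$ points and $N$ blocks, listed in any order, and with given parameters $(a,b,c)$, let $U_-\in M_N(\mathbb R)$ be the matrix whose $(i,j)$ entry is $x$ if the $i$-th point lies on the $j$-th block, and $y$ otherwise. **Theorem.** For each of the following real matrices $H$, the matrix $H/\sqrt N$ is unitary, but it is not a local maximizer of the 1-norm on $U(N)$; thus $H$ is not complex almost Hadamard. 1. $K_N=\frac{1}{\sqrt N}(2\,\mathbb I_N-N1_N)$, for every $N\ge 2$ with $N\ne 4$, where $\mathbb I_N$ is the all-one matrix and $1_N$ is the identity matrix. 2. $I_N^{q,d}=\sqrt N\,U_-$, for every finite field $\mathbb F_q$ and every integer $d\ge 1$, where $U_-$ is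 built from the points (the lines through the origin of $\mathbb F_q^{d+2}$) and the hyperplanes (the linear subspaces of $\mathbb F_q^{d+2}$ of dimension $d+1$), a point being on a hyperplane if it is contained in it, and with $(a,b,c)=\left(\frac{q^d-1}{q-1},\,q^d,\,q^d(q-1)\right)$. 3. $P_{11}=\sqrt{11}\,U_-$, where $U_-$ is built from the Paley biplane, whose points are the elements of $\mathbb Z/11$ and whose blocks are the $11$ translates of the set $\{1,3,4,5,9\}$ of nonzero squares, with $(a,b,c)=(2,3,3)$. -/

import Mathlib

open scoped Matrix LinearAlgebra.Projectivization

noncomputable section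

/-- The entrywise 1-norm `∑ |U i j|` of a complex matrix. -/
def oneNorm {N : ℕ} (U : Matrix (Fin N) (Fin N) ℂ) : ℝ :=
  ∑ i, ∑ j, ‖U i j‖

/-- The rescaling `U = H / √N` of an `N × N` matrix. -/
def rescale {N : ℕ} (H : Matrix (Fin N) (Fin N) ℂ) : Matrix (Fin N) (Fin N) ℂ :=
  ((Real.sqrt N : ℝ) : ℂ)⁻¹ • H

/-- `H` is complex almost Hadamard: `U = H / √N` is unitary and is a local maximizer of the
1-norm on the unitary group `U(N)`. -/
def IsComplexAlmostHadamard {N : ℕ} (H : Matrix (Fin N) (Fin N) ℂ) : Prop :=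
  rescale H ∈ Matrix.unitaryGroup (Fin N) ℂ ∧
    IsLocalMaxOn oneNorm
      (Matrix.unitaryGroup (Fin N) ℂ : Set (Matrix (Fin N) (Fin N) ℂ)) (rescale H)

/-- A real matrix, seen as a complex one. -/
def toComplex {N : ℕ} (H : Matrix (Fin N) (Fin N) ℝ) : Matrix (Fin N) (Fin N) ℂ :=
  H.map (fun r : ℝ => (r : ℂ))

/-- `K_N = (2 𝕀_N - N 1_N) / √N`, where `𝕀_N` is the all-one matrix: the diagonal entries are
`(2 - N) / √N` and the other ones are `2 / √N`. -/
def matrixK (N : ℕ) : Matrix (Fin N) (Fin N) ℝ :=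
  (Real.sqrt N)⁻¹ • ((2 : ℝ) • Matrix.of (fun _ _ => (1 : ℝ)) - (N : ℝ) • 1)

/-- The smaller root `t` of `a t² - 2 b t + c = 0` (used for `a > 0` and `a c ≤ b²`). -/
def smallRoot (a b c : ℝ) : ℝ :=
  (b - Real.sqrt (b ^ 2 - a * c)) / a

/-- The entry `x = -t / (√b (t + 1))` of the matrix `U₋`, put at the incident pairs. -/
def entryX (a b c : ℝ) : ℝ :=
  -smallRoot a b c / (Real.sqrt b * (smallRoot a b c + 1))

/-- The entry `y = 1 / (√b (t + 1))` of the matrix `U₋`, put at the non-incident pairs. -/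
def entryY (a b c : ℝ) : ℝ :=
  1 / (Real.sqrt b * (smallRoot a b c + 1))

open Classical in
/-- The matrix `√N U₋` of an incidence relation `inc` between points and blocks, where `U₋` has
entry `x` if the `i`-th point is in the `j`-th block and entry `y` otherwise. The points and the
blocks are listed by `e` and `f`. -/
def designMatrix {N : ℕ} {P L : Type*} (a b c : ℝ) (inc : P → L → Prop)
    (e : Fin N ≃ P) (f : Fin N ≃ L) : Matrix (Fin N) (Fin N) ℝ :=
  Real.sqrt N • Matrix.of
    (fun i j => if inc (e i) (f j) then entryX a b c else entryY a b c)

/-- The points of the projective geometry `PG(d+1, F)`. -/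
abbrev ProjPoint (F : Type*) [Field F] (d : ℕ) : Type _ :=
  ℙ F (Fin (d + 2) → F)

/-- The hyperplanes of the projective geometry `PG(d+1, F)`, that is, the linear subspaces of
dimension `d + 1` of `F ^ (d + 2)`. -/
abbrev ProjHyperplane (F : Type*) [Field F] (d : ℕ) : Type _ :=
  {W : Submodule F (Fin (d + 2) → F) // Module.finrank F W = d + 1}

/-- The matrix `I_N^{q,d}`, where `q = |F|`: the matrix `√N U₋` of the design of points and
hyperplanes of `PG(d+1, F)`, with parameters
`(a, b, c) = ((q ^ d - 1) / (q - 1), q ^ d, q ^ d (q - 1))`. -/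
def matrixI (F : Type*) [Field F] [Fintype F] (d : ℕ) {N : ℕ}
    (e : Fin N ≃ ProjPoint F d) (f : Fin N ≃ ProjHyperplane F d) :
    Matrix (Fin N) (Fin N) ℝ :=
  designMatrix
    (((Fintype.card F : ℝ) ^ d - 1) / ((Fintype.card F : ℝ) - 1))
    ((Fintype.card F : ℝ) ^ d)
    ((Fintype.card F : ℝ) ^ d * ((Fintype.card F : ℝ) - 1))
    (fun (p : ProjPoint F d) (W : ProjHyperplane F d) => p.submodule ≤ W.1) e f

/-- Incidence in the Paley biplane: the points are the elements of `ℤ/11`, the blocks are the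
translates `Q + j`, with `j ∈ ℤ/11`, of the set `Q = {1, 3, 4, 5, 9}` of nonzero squares. -/
def paleyIncident (i j : ZMod 11) : Prop :=
  i - j ≠ 0 ∧ IsSquare (i - j)

/-- The matrix `P_11`: the matrix `√11 U₋` of the Paley biplane, which has parameters
`(a, b, c) = (2, 3, 3)`. -/
def matrixP11 (e f : Fin 11 ≃ ZMod 11) : Matrix (Fin 11) (Fin 11) ℝ :=
  designMatrix 2 3 3 paleyIncident e f

end

open Filter Topology

/-! Complex unitaries leave room that real ones do not. Let `P` project onto the line of `e_j - e_k`
and let `z = exp (iθ)`. Right multiplication of a real orthogonal `V` by `1 + (z - 1) P` changes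
only columns `j` and `k`: in each row, entries `p, q` get squared moduli `c p² + (1 - c) q²` and `(1
- c) p² + c q²`, with `c = cos² (θ/2)`. Their sum is unchanged while their product grows by `c (1 -
c) (p² - q²)²`, so `|p| + |q|` never drops and strictly increases if `|p| ≠ |q|`. Hence a real
orthogonal matrix with two different absolute values in some row is never a local maximizer
(`not_isLocalMaxOn_oneNorm`).

For each family it remains to check orthogonality, which for designs is a count of points on blocks,
and to find such a row. -/

/-- If `P` is a self-adjoint idempotent and `z` is unimodular, `1 + (z - 1) P` is unitary. -/
lemma one_add_sub_one_smul_mem_unitaryGroup {n : Type*} [Fintype n] [DecidableEq n]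
    {P : Matrix n n ℂ} (hs : star P = P) (hi : P * P = P) {z : ℂ} (hz : star z * z = 1) :
    1 + (z - 1) • P ∈ Matrix.unitaryGroup n ℂ := by
  rw [Matrix.mem_unitaryGroup_iff', star_add, star_one, star_smul, hs]
  simp only [add_mul, mul_add, one_mul, mul_one, smul_mul_smul_comm, hi, star_sub, star_one]
  rw [add_assoc, ← add_smul, ← add_smul]
  -- The left side is `|z|² - 1`.
  have h : (star z - 1) + ((z - 1) + (star z - 1) * (z - 1)) = 0 := by
    linear_combination hz
  rw [h, zero_smul, add_zero]

/-- The orthogonal projection onto the line spanned by `e_j - e_k`. -/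
noncomputable def diffProj {n : Type*} [DecidableEq n] (j k : n) : Matrix n n ℂ :=
  (2⁻¹ : ℂ) • Matrix.vecMulVec (Pi.single j 1 - Pi.single k 1) (Pi.single j 1 - Pi.single k 1)

lemma star_diffProj {n : Type*} [DecidableEq n] (j k : n) :
    star (diffProj j k) = diffProj j k := by
  ext a b
  simp only [diffProj, Matrix.star_apply, Matrix.smul_apply, Matrix.vecMulVec_apply,
    Pi.sub_apply, Pi.single_apply, smul_eq_mul]
  split_ifs <;> simp

lemma mul_diffProj_apply {n : Type*} [Fintype n] [DecidableEq n] (U : Matrix n n ℂ)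
    (j k i l : n) :
    (U * diffProj j k) i l =
      2⁻¹ * (U i j - U i k) * ((Pi.single j 1 - Pi.single k 1 : n → ℂ) l) := by
  simp [diffProj, Matrix.mul_vecMulVec, Matrix.vecMulVec_apply, Matrix.mulVec_sub, mul_assoc]

lemma diffProj_mul_self {n : Type*} [Fintype n] [DecidableEq n] {j k : n} (h : j ≠ k) :
    diffProj j k * diffProj j k = diffProj j k := by
  ext a b
  rw [mul_diffProj_apply]
  simp [diffProj, Matrix.vecMulVec_apply, h, h.symm]
  ring

/-- The norm of a real pair `(p, q)` averaged along the circle. -/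
lemma norm_add_exp_sub_one_mul (p q θ : ℝ) :
    ‖(p : ℂ) + (Complex.exp (θ * Complex.I) - 1) * (2⁻¹ * (p - q))‖ =
      Real.sqrt ((1 + Real.cos θ) / 2 * p ^ 2 + (1 - Real.cos θ) / 2 * q ^ 2) := by
  have h : (p : ℂ) + (Complex.exp (θ * Complex.I) - 1) * (2⁻¹ * (p - q)) =
      ⟨(1 + Real.cos θ) / 2 * p + (1 - Real.cos θ) / 2 * q, Real.sin θ * (p - q) / 2⟩ := by
    apply Complex.ext
    · simp [Complex.exp_ofReal_mul_I_re, Complex.exp_ofReal_mul_I_im]; ring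
    · simp [Complex.exp_ofReal_mul_I_re, Complex.exp_ofReal_mul_I_im]; ring
  rw [h, Complex.norm_def, Complex.normSq_mk]
  congr 1
  linear_combination (p - q) ^ 2 / 4 * Real.sin_sq_add_cos_sq θ

/-- Both sides are sums of two nonnegative numbers whose squares add up to `p² + q²`, so it suffices
to compare products; the squared products differ by `c (1 - c) (p² - q²)²`. -/
lemma abs_add_abs_le_sqrt_add_sqrt {c p q : ℝ} (h0 : 0 ≤ c) (h1 : c ≤ 1) :
    |p| + |q| ≤ √(c * p ^ 2 + (1 - c) * q ^ 2) + √((1 - c) * p ^ 2 + c * q ^ 2) := by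
  have h1' : 0 ≤ 1 - c := by linarith
  have hA : 0 ≤ c * p ^ 2 + (1 - c) * q ^ 2 := by positivity
  have hB : 0 ≤ (1 - c) * p ^ 2 + c * q ^ 2 := by positivity
  have hm : |p| * |q| ≤ √(c * p ^ 2 + (1 - c) * q ^ 2) * √((1 - c) * p ^ 2 + c * q ^ 2) := by
    rw [← Real.sqrt_mul hA, ← abs_mul]
    apply Real.abs_le_sqrt
    nlinarith [mul_nonneg (mul_nonneg h0 h1') (sq_nonneg (p ^ 2 - q ^ 2))]
  refine (sq_le_sq₀ (by positivity) (by positivity)).1 ?_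
  nlinarith [Real.sq_sqrt hA, Real.sq_sqrt hB, sq_abs p, sq_abs q]

lemma abs_add_abs_lt_sqrt_add_sqrt {c p q : ℝ} (h0 : 0 < c) (h1 : c < 1) (hpq : |p| ≠ |q|) :
    |p| + |q| < √(c * p ^ 2 + (1 - c) * q ^ 2) + √((1 - c) * p ^ 2 + c * q ^ 2) := by
  have h1' : 0 < 1 - c := by linarith
  have hA : 0 ≤ c * p ^ 2 + (1 - c) * q ^ 2 := by positivity
  have hB : 0 ≤ (1 - c) * p ^ 2 + c * q ^ 2 := by positivity
  have hd : 0 < (p ^ 2 - q ^ 2) ^ 2 := by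
    have : p ^ 2 - q ^ 2 ≠ 0 := fun h => hpq ((sq_eq_sq_iff_abs_eq_abs p q).1 (by linarith))
    positivity
  have hm : |p| * |q| < √(c * p ^ 2 + (1 - c) * q ^ 2) * √((1 - c) * p ^ 2 + c * q ^ 2) := by
    rw [← Real.sqrt_mul hA, ← abs_mul]
    apply Real.lt_sqrt_of_sq_lt
    rw [sq_abs]
    nlinarith [mul_pos (mul_pos h0 h1') hd]
  apply lt_of_pow_lt_pow_left₀ 2 (by positivity)
  nlinarith [Real.sq_sqrt hA, Real.sq_sqrt hB, sq_abs p, sq_abs q]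

/-- Rotating two columns of a real matrix through the complex numbers increases the 1-norm, as
soon as the two columns do not have the same absolute values. -/
lemma oneNorm_lt_oneNorm_mul {N : ℕ} (V : Matrix (Fin N) (Fin N) ℝ) {i j k : Fin N}
    (hjk : j ≠ k) (hi : |V i j| ≠ |V i k|) {θ : ℝ} (h0 : 0 < θ) (hπ : θ < Real.pi) :
    oneNorm (toComplex V) <
      oneNorm (toComplex V * (1 + (Complex.exp (θ * Complex.I) - 1) • diffProj j k)) := by
  set z := Complex.exp (θ * Complex.I) with hz
  set W := toComplex V * (1 + (z - 1) • diffProj j k) with hW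
  have hWapp : ∀ a b, W a b = (V a b : ℂ) + (z - 1) * (2⁻¹ * ((V a j : ℂ) - V a k) *
      ((Pi.single j 1 - Pi.single k 1 : Fin N → ℂ) b)) := by
    intro a b
    rw [hW, mul_add, mul_one, Matrix.mul_smul, Matrix.add_apply, Matrix.smul_apply,
      mul_diffProj_apply]
    simp [toComplex]
  -- This is `cos² (θ/2)`, strictly between 0 and 1 for `0 < θ < π`.
  set c := (1 + Real.cos θ) / 2 with hc
  have hc' : (1 - Real.cos θ) / 2 = 1 - c := by rw [hc]; ring
  have hc0 : 0 < c := by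
    have : Real.cos Real.pi < Real.cos θ := Real.cos_lt_cos_of_nonneg_of_le_pi h0.le le_rfl hπ
    rw [Real.cos_pi] at this
    rw [hc]; linarith
  have hc1 : c < 1 := by
    have : Real.cos θ < Real.cos 0 := Real.cos_lt_cos_of_nonneg_of_le_pi le_rfl hπ.le h0
    rw [Real.cos_zero] at this
    rw [hc]; linarith
  have hWj : ∀ a, ‖W a j‖ = √(c * V a j ^ 2 + (1 - c) * V a k ^ 2) := by
    intro a
    rw [← hc', hc, ← norm_add_exp_sub_one_mul, hWapp]
    simp [hjk, hz]
  have hWk : ∀ a, ‖W a k‖ = √((1 - c) * V a j ^ 2 + c * V a k ^ 2) := by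
    intro a
    -- Column `k` is the same computation with `p` and `q` exchanged.
    rw [add_comm, ← hc', hc, ← norm_add_exp_sub_one_mul, hWapp]
    congr 1
    simp [hjk.symm, hz]
    ring
  have hWl : ∀ a l, l ≠ j → l ≠ k → ‖W a l‖ = ‖toComplex V a l‖ := by
    intro a l hj hk
    rw [hWapp]
    simp [hj, hk, toComplex]
  have split : ∀ (g : Fin N → ℝ), ∑ l, g l =
      g j + g k + ∑ l ∈ (Finset.univ.erase j).erase k, g l := by
    intro g
    rw [add_assoc, Finset.add_sum_erase _ _ (by simp [hjk.symm]), Finset.add_sum_erase _ _ (by simp)]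
  have rest : ∀ a, ∑ l ∈ (Finset.univ.erase j).erase k, ‖W a l‖ =
      ∑ l ∈ (Finset.univ.erase j).erase k, ‖toComplex V a l‖ := by
    intro a
    refine Finset.sum_congr rfl fun l hl => ?_
    simp only [Finset.mem_erase] at hl
    exact hWl a l hl.2.1 hl.1
  have hV : ∀ a b, ‖toComplex V a b‖ = |V a b| := fun a b => by simp [toComplex]
  unfold oneNorm
  refine Finset.sum_lt_sum (fun a _ => ?_) ⟨i, Finset.mem_univ _, ?_⟩
  · rw [split, split (fun l => ‖W a l‖), rest, hWj, hWk, hV, hV]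
    gcongr ?_ + _
    exact abs_add_abs_le_sqrt_add_sqrt hc0.le hc1.le
  · rw [split, split (fun l => ‖W i l‖), rest, hWj, hWk, hV, hV]
    gcongr ?_ + _
    exact abs_add_abs_lt_sqrt_add_sqrt hc0 hc1 hi

/-- A real unitary matrix having two entries of different absolute values in the same row is not
a local maximizer of the 1-norm on the unitary group. -/
theorem not_isLocalMaxOn_oneNorm {N : ℕ} (V : Matrix (Fin N) (Fin N) ℝ)
    (hV : toComplex V ∈ Matrix.unitaryGroup (Fin N) ℂ) {i j k : Fin N}
    (hi : |V i j| ≠ |V i k|) :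
    ¬ IsLocalMaxOn oneNorm
      (Matrix.unitaryGroup (Fin N) ℂ : Set (Matrix (Fin N) (Fin N) ℂ)) (toComplex V) := by
  intro hmax
  have hjk : j ≠ k := by rintro rfl; exact hi rfl
  set g : ℝ → Matrix (Fin N) (Fin N) ℂ := fun θ =>
    toComplex V * (1 + (Complex.exp (θ * Complex.I) - 1) • diffProj j k) with hg
  have hcont : Continuous g := by
    have hz : Continuous fun θ : ℝ => Complex.exp (θ * Complex.I) - 1 := by fun_prop
    exact continuous_const.matrix_mul (continuous_const.add (hz.smul continuous_const))
  have hg0 : g 0 = toComplex V := by simp [hg]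
  have hmem : ∀ θ, g θ ∈ (Matrix.unitaryGroup (Fin N) ℂ : Set (Matrix (Fin N) (Fin N) ℂ)) := by
    intro θ
    refine mul_mem hV (one_add_sub_one_smul_mem_unitaryGroup (star_diffProj j k)
      (diffProj_mul_self hjk) ?_)
    rw [Complex.star_def, Complex.conj_mul', Complex.norm_exp_ofReal_mul_I]
    simp
  -- The approach is from the right, since the strict increase is available for `0 < θ < π`.
  have ht : Tendsto g (𝓝[>] 0) (𝓝[(Matrix.unitaryGroup (Fin N) ℂ :
      Set (Matrix (Fin N) (Fin N) ℂ))] (toComplex V)) := by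
    refine tendsto_nhdsWithin_iff.2 ⟨?_, Eventually.of_forall hmem⟩
    have := (hcont.tendsto 0).mono_left (nhdsWithin_le_nhds (s := Set.Ioi 0))
    rwa [hg0] at this
  have hev : ∀ᶠ θ : ℝ in 𝓝[>] 0, oneNorm (g θ) ≤ oneNorm (toComplex V) := ht.eventually hmax
  have hlt : ∀ᶠ θ : ℝ in 𝓝[>] 0, θ ∈ Set.Ioo 0 Real.pi := Ioo_mem_nhdsGT Real.pi_pos
  obtain ⟨θ, h1, h2⟩ := (hev.and hlt).exists
  exact absurd h1 (not_le.2 (oneNorm_lt_oneNorm_mul V hjk hi h2.1 h2.2))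

/-! ### From real orthogonal matrices to `IsComplexAlmostHadamard` -/

lemma rescale_toComplex {N : ℕ} (H : Matrix (Fin N) (Fin N) ℝ) :
    rescale (toComplex H) = toComplex ((√(N : ℝ))⁻¹ • H) := by
  ext i j
  simp [rescale, toComplex]

lemma toComplex_mem_unitaryGroup {N : ℕ} {V : Matrix (Fin N) (Fin N) ℝ} (hV : Vᵀ * V = 1) :
    toComplex V ∈ Matrix.unitaryGroup (Fin N) ℂ := by
  rw [Matrix.mem_unitaryGroup_iff']
  ext i j
  have h := congrArg (fun r : ℝ => (r : ℂ)) (congrFun (congrFun hV i) j)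
  simp only [Matrix.mul_apply, Matrix.transpose_apply, Matrix.one_apply] at h
  simp only [toComplex, Matrix.mul_apply, Matrix.star_apply, Matrix.map_apply, Matrix.one_apply,
    Complex.star_def, Complex.conj_ofReal]
  rw [apply_ite Complex.ofReal] at h
  simpa using h

/-- A real matrix `H` with `H / √N` orthogonal, having two entries of different absolute values in
the same row, is not complex almost Hadamard. -/
theorem not_isComplexAlmostHadamard_of_abs_ne {N : ℕ} (H : Matrix (Fin N) (Fin N) ℝ)
    (hH : ((√(N : ℝ))⁻¹ • H)ᵀ * ((√(N : ℝ))⁻¹ • H) = 1) {i j k : Fin N}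
    (hi : |((√(N : ℝ))⁻¹ • H) i j| ≠ |((√(N : ℝ))⁻¹ • H) i k|) :
    rescale (toComplex H) ∈ Matrix.unitaryGroup (Fin N) ℂ ∧
      ¬ IsComplexAlmostHadamard (toComplex H) := by
  have hu := toComplex_mem_unitaryGroup hH
  rw [← rescale_toComplex] at hu
  refine ⟨hu, fun h => ?_⟩
  have h2 := h.2
  rw [rescale_toComplex] at h2 hu
  exact not_isLocalMaxOn_oneNorm _ hu hi h2

/-! ### The matrices `K_N` -/

lemma inv_sqrt_smul_matrixK (N : ℕ) (hN : 0 < N) :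
    (√(N : ℝ))⁻¹ • matrixK N =
      (2 / (N : ℝ)) • Matrix.of (fun _ _ => (1 : ℝ)) - (1 : Matrix (Fin N) (Fin N) ℝ) := by
  have hN' : (N : ℝ) ≠ 0 := by positivity
  have h : (√(N : ℝ))⁻¹ * (√(N : ℝ))⁻¹ = (N : ℝ)⁻¹ := by
    rw [← mul_inv, Real.mul_self_sqrt (by positivity)]
  rw [matrixK, smul_smul, h, smul_sub, smul_smul, smul_smul, inv_mul_cancel₀ hN', one_smul,
    mul_comm, ← div_eq_mul_inv]

theorem matrixK_not_isComplexAlmostHadamard {N : ℕ} (h2 : 2 ≤ N) (h4 : N ≠ 4) :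
    rescale (toComplex (matrixK N)) ∈ Matrix.unitaryGroup (Fin N) ℂ ∧
      ¬ IsComplexAlmostHadamard (toComplex (matrixK N)) := by
  have hN : (2 : ℝ) ≤ N := by exact_mod_cast h2
  have hN0 : (N : ℝ) ≠ 0 := by positivity
  have h4' : (N : ℝ) ≠ 4 := by exact_mod_cast h4
  refine not_isComplexAlmostHadamard_of_abs_ne (matrixK N) ?_ (i := ⟨0, by omega⟩)
    (j := ⟨0, by omega⟩) (k := ⟨1, by omega⟩) ?_
  · rw [inv_sqrt_smul_matrixK N (by omega)]
    have hJJ : (Matrix.of fun _ _ => (1 : ℝ) : Matrix (Fin N) (Fin N) ℝ) *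
        (Matrix.of fun _ _ => (1 : ℝ)) = (N : ℝ) • Matrix.of fun _ _ => (1 : ℝ) := by
      ext i j
      simp [Matrix.mul_apply]
    have hJt : (Matrix.of fun _ _ => (1 : ℝ) : Matrix (Fin N) (Fin N) ℝ)ᵀ =
        Matrix.of fun _ _ => (1 : ℝ) := rfl
    rw [Matrix.transpose_sub, Matrix.transpose_smul, hJt, Matrix.transpose_one, sub_mul, mul_sub,
      mul_sub, smul_mul_smul_comm, hJJ, smul_smul, mul_one, one_mul, mul_one]
    have : 2 / (N : ℝ) * (2 / N) * N = 2 / N + 2 / N := by field_simp; norm_num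
    rw [this, add_smul]
    abel
  · rw [inv_sqrt_smul_matrixK N (by omega)]
    simp only [Matrix.sub_apply, Matrix.smul_apply, Matrix.of_apply, smul_eq_mul, mul_one,
      Matrix.one_apply_eq]
    rw [Matrix.one_apply_ne (by simp), sub_zero]
    -- The entries are `2/N - 1` and `2/N`; they are never equal, and are opposite only for `N = 4`.
    intro h
    rcases abs_eq_abs.1 h with h | h
    · linarith
    · field_simp at h
      exact h4' (by linarith)

/-! ### Matrices of symmetric designs -/

lemma smallRoot_eq {a b c : ℝ} (ha : 0 < a) (hac : a * c < b ^ 2) :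
    a * smallRoot a b c ^ 2 - 2 * b * smallRoot a b c + c = 0 := by
  have hs : √(b ^ 2 - a * c) ^ 2 = b ^ 2 - a * c := Real.sq_sqrt (by linarith)
  unfold smallRoot
  field_simp
  linear_combination hs

lemma smallRoot_pos {a b c : ℝ} (ha : 0 < a) (hb : 0 < b) (hc : 0 < c) :
    0 < smallRoot a b c := by
  refine div_pos (sub_pos.2 ?_) ha
  rw [Real.sqrt_lt' hb]
  nlinarith [mul_pos ha hc]

lemma entryX_eq (a b c : ℝ) : entryX a b c = -smallRoot a b c * entryY a b c := by
  simp [entryX, entryY, div_eq_mul_inv]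

lemma entryY_pos {a b c : ℝ} (ha : 0 < a) (hb : 0 < b) (hc : 0 < c) : 0 < entryY a b c := by
  have := smallRoot_pos ha hb hc
  unfold entryY
  positivity

/-- `x - y = -1/√b`. This is the difference between the diagonal and off-diagonal entries of the
Gram matrix of `U₋`. -/
lemma mul_entryX_sub_entryY_sq {a b c : ℝ} (ha : 0 < a) (hb : 0 < b) (hc : 0 < c) :
    b * (entryX a b c - entryY a b c) ^ 2 = 1 := by
  have := smallRoot_pos ha hb hc
  have hs : √b ^ 2 = b := Real.sq_sqrt hb.le
  rw [entryX_eq, entryY]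
  field_simp
  rw [hs]
  ring

/-- The equation of `t`, made homogeneous by `x = -t y`; it says that distinct columns of `U₋` are
orthogonal. -/
lemma entryX_entryY_quadratic {a b c : ℝ} (ha : 0 < a) (hac : a * c < b ^ 2) :
    a * entryX a b c ^ 2 + 2 * b * (entryX a b c * entryY a b c) + c * entryY a b c ^ 2 = 0 := by
  rw [entryX_eq]
  linear_combination entryY a b c ^ 2 * smallRoot_eq ha hac

/-- The ratio `|x| / |y|` is `t`, and `t = 1` would force `a - 2 b + c = 0`. -/
lemma abs_entryX_ne_abs_entryY {a b c : ℝ} (ha : 0 < a) (hb : 0 < b) (hc : 0 < c)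
    (hac : a * c < b ^ 2) (hne : a - 2 * b + c ≠ 0) : |entryX a b c| ≠ |entryY a b c| := by
  have ht := smallRoot_pos ha hb hc
  have hy := entryY_pos ha hb hc
  rw [entryX_eq, abs_mul, abs_neg, abs_of_pos ht, abs_of_pos hy]
  intro h
  have h1 : smallRoot a b c = 1 := mul_right_cancel₀ hy.ne' (h.trans (one_mul _).symm)
  have h2 := smallRoot_eq ha hac
  rw [h1] at h2
  exact hne (by linarith)

lemma sum_ite_eq_card {N : ℕ} {P : Type*} (e : Fin N ≃ P) (S : P → Prop)
    [DecidablePred fun i => S (e i)] :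
    ∑ i, (if S (e i) then (1 : ℝ) else 0) = Nat.card {p // S p} := by
  rw [Finset.sum_boole, ← Fintype.card_subtype, ← Nat.card_eq_fintype_card]
  exact congrArg _ (Nat.card_congr (e.subtypeEquiv fun _ => Iff.rfl))

/-- The matrix `√N U₋` of a symmetric design with block size `a + b`, block intersection number
`a`, and `a + 2 b + c` points. -/
theorem designMatrix_not_isComplexAlmostHadamard {N : ℕ} {P L : Type*} {a b c : ℝ}
    (ha : 0 < a) (hb : 0 < b) (hc : 0 < c) (hac : a * c < b ^ 2) (hne : a - 2 * b + c ≠ 0)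
    {inc : P → L → Prop} (e : Fin N ≃ P) (f : Fin N ≃ L)
    (hN : (N : ℝ) = a + 2 * b + c) (hN2 : 2 ≤ N)
    (hblock : ∀ l, (Nat.card {p // inc p l} : ℝ) = a + b)
    (hinter : ∀ l l', l ≠ l' → (Nat.card {p // inc p l ∧ inc p l'} : ℝ) = a) :
    rescale (toComplex (designMatrix a b c inc e f)) ∈ Matrix.unitaryGroup (Fin N) ℂ ∧
      ¬ IsComplexAlmostHadamard (toComplex (designMatrix a b c inc e f)) := by
  classical
  set x := entryX a b c with hx
  set y := entryY a b c with hy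
  have hb1 : b * (x - y) ^ 2 = 1 := mul_entryX_sub_entryY_sq ha hb hc
  have hq : a * x ^ 2 + 2 * b * (x * y) + c * y ^ 2 = 0 := entryX_entryY_quadratic ha hac
  have hxy : |x| ≠ |y| := abs_entryX_ne_abs_entryY ha hb hc hac hne
  have hM : ∀ i j, ((√(N : ℝ))⁻¹ • designMatrix a b c inc e f) i j =
      if inc (e i) (f j) then x else y := by
    intro i j
    have h0 : √(N : ℝ) ≠ 0 := by
      have : 0 < N := by omega
      positivity
    simp only [designMatrix, smul_smul, inv_mul_cancel₀ h0, one_smul, Matrix.of_apply, hx, hy]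
  have hs : ∀ j, ∑ i, (if inc (e i) (f j) then (1 : ℝ) else 0) = a + b := fun j => by
    rw [← hblock (f j)]; exact sum_ite_eq_card e (fun p => inc p (f j))
  have hs2 : ∀ j k, j ≠ k → ∑ i, (if inc (e i) (f j) ∧ inc (e i) (f k) then (1 : ℝ) else 0) = a :=
    fun j k hjk => by
      rw [← hinter (f j) (f k) (f.injective.ne hjk)]
      exact sum_ite_eq_card e (fun p => inc p (f j) ∧ inc p (f k))
  have hjk : (⟨0, by omega⟩ : Fin N) ≠ ⟨1, by omega⟩ := by simp
  generalize (⟨0, by omega⟩ : Fin N) = j₀ at hjk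
  generalize (⟨1, by omega⟩ : Fin N) = k₀ at hjk
  -- Otherwise one block would lie inside the other, giving `a + b = a`.
  obtain ⟨i, hij, hik⟩ : ∃ i, inc (e i) (f j₀) ∧ ¬ inc (e i) (f k₀) := by
    by_contra! h
    have h1 := hs j₀
    have h2 := hs2 j₀ k₀ hjk
    simp only [and_iff_left_of_imp (h _)] at h2
    linarith
  refine not_isComplexAlmostHadamard_of_abs_ne _ ?_ (i := i) (j := j₀) (k := k₀) ?_
  · ext j k
    rw [Matrix.mul_apply]
    simp only [Matrix.transpose_apply, hM]
    by_cases hjk : j = k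
    · subst hjk
      -- Products of entries are affine in incidence indicators, so Gram entries depend only on
      -- block and intersection sizes.
      have : ∀ i, (if inc (e i) (f j) then x else y) * (if inc (e i) (f j) then x else y) =
          y ^ 2 + (x ^ 2 - y ^ 2) * (if inc (e i) (f j) then 1 else 0) := by
        intro i; split_ifs <;> ring
      simp only [this, Finset.sum_add_distrib, ← Finset.mul_sum, hs, Matrix.one_apply_eq]
      simp [hN]
      linear_combination hq + hb1
    · have : ∀ i, (if inc (e i) (f j) then x else y) * (if inc (e i) (f k) then x else y) =
          y ^ 2 + (x - y) * y * (if inc (e i) (f j) then 1 else 0) +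
          (x - y) * y * (if inc (e i) (f k) then 1 else 0) +
          (x - y) ^ 2 * (if inc (e i) (f j) ∧ inc (e i) (f k) then 1 else 0) := by
        intro i
        by_cases h1 : inc (e i) (f j) <;> by_cases h2 : inc (e i) (f k) <;> simp [h1, h2] <;> ring
      simp only [this, Finset.sum_add_distrib, ← Finset.mul_sum, hs, hs2 j k hjk,
        Matrix.one_apply_ne hjk]
      simp [hN]
      linear_combination hq
  · rw [hM, hM, if_pos hij, if_neg hik]
    exact hxy

/-! ### Projective geometries -/

/-- The points of `ℙ F V` on a subspace `W` are the points of `ℙ F W`. -/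
lemma card_submodule_le {F V : Type*} [Field F] [AddCommGroup V] [Module F V]
    (W : Submodule F V) :
    Nat.card {p : ℙ F V // p.submodule ≤ W} = Nat.card (ℙ F W) := by
  have hinj : Function.Injective W.subtype := W.injective_subtype
  refine (Nat.card_congr (Equiv.ofBijective (fun p : ℙ F W =>
    (⟨Projectivization.map W.subtype hinj p, ?_⟩ : {p : ℙ F V // p.submodule ≤ W})) ⟨?_, ?_⟩)).symm
  · induction p using Projectivization.ind with
    | h v hv =>
      rw [Projectivization.map_mk, Projectivization.submodule_mk, Submodule.span_singleton_le_iff_mem]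
      exact v.2
  · intro p q h
    exact Projectivization.map_injective _ hinj (Subtype.ext_iff.1 h)
  · rintro ⟨p, hp⟩
    induction p using Projectivization.ind with
    | h v hv =>
      rw [Projectivization.submodule_mk, Submodule.span_singleton_le_iff_mem] at hp
      refine ⟨Projectivization.mk F (⟨v, hp⟩ : W) (by simpa using hv), ?_⟩
      exact Subtype.ext (Projectivization.map_mk _ hinj _ _)

/-- Two distinct hyperplanes span the whole space; the dimension formula then gives the
intersection. -/
lemma finrank_inf_of_finrank_eq {F V : Type*} [Field F] [AddCommGroup V] [Module F V]
    {n : ℕ} (hV : Module.finrank F V = n + 2) {W W' : Submodule F V}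
    (hW : Module.finrank F W = n + 1) (hW' : Module.finrank F W' = n + 1) (hne : W ≠ W') :
    Module.finrank F ↥(W ⊓ W') = n := by
  have : FiniteDimensional F V := Module.finite_of_finrank_pos (by omega)
  have h := Submodule.finrank_sup_add_finrank_inf_eq W W'
  have hle := Submodule.finrank_le (W ⊔ W')
  have hlt : Module.finrank F W < Module.finrank F ↥(W ⊔ W') := by
    refine Submodule.finrank_lt_finrank_of_lt (lt_of_le_of_ne le_sup_left fun heq => hne ?_)
    have : W' ≤ W := by rw [heq]; exact le_sup_right
    exact (Submodule.eq_of_le_of_finrank_eq this (by omega)).symm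
  omega

lemma card_projectivization_eq_div {F V : Type*} [Field F] [Fintype F] [AddCommGroup V]
    [Module F V] {n : ℕ} (h : Module.finrank F V = n) :
    (Nat.card (ℙ F V) : ℝ) =
      ((Fintype.card F : ℝ) ^ n - 1) / ((Fintype.card F : ℝ) - 1) := by
  have hq : (1 : ℝ) < Fintype.card F := by exact_mod_cast Fintype.one_lt_card
  rw [Projectivization.card_of_finrank F V h, ← geom_sum_eq hq.ne', Nat.card_eq_fintype_card]
  push_cast
  rfl

theorem matrixI_not_isComplexAlmostHadamard (F : Type*) [Field F] [Fintype F] {d : ℕ}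
    (hd : 1 ≤ d) {N : ℕ} (e : Fin N ≃ ProjPoint F d) (f : Fin N ≃ ProjHyperplane F d) :
    rescale (toComplex (matrixI F d e f)) ∈ Matrix.unitaryGroup (Fin N) ℂ ∧
      ¬ IsComplexAlmostHadamard (toComplex (matrixI F d e f)) := by
  set q : ℝ := (Fintype.card F : ℝ) with hq
  have hq2n : 2 ≤ Fintype.card F := Fintype.one_lt_card
  have hq2 : 2 ≤ q := by rw [hq]; exact_mod_cast hq2n
  have hq1 : 0 < q - 1 := by linarith
  have hqd : q ≤ q ^ d := le_self_pow₀ (by linarith) (by omega)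
  have ha : 0 < (q ^ d - 1) / (q - 1) := div_pos (by linarith) hq1
  have hb : 0 < q ^ d := by positivity
  have hV : Module.finrank F (Fin (d + 2) → F) = d + 2 := by simp
  have hN : (N : ℝ) = (q ^ d - 1) / (q - 1) + 2 * q ^ d + q ^ d * (q - 1) := by
    have h1 : N = Nat.card (ProjPoint F d) := by rw [← Nat.card_congr e, Nat.card_fin]
    rw [h1, card_projectivization_eq_div hV, ← hq]
    field_simp
    ring
  refine designMatrix_not_isComplexAlmostHadamard ha hb (mul_pos hb hq1) ?_ ?_ e f hN ?_ ?_ ?_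
  -- Here `a c = q^d (q^d - 1)`.
  · rw [← mul_assoc, mul_right_comm, div_mul_cancel₀ _ hq1.ne']
    nlinarith
  -- `a - 2 b + c = a + q^d (q - 3)` is positive for `q ≥ 3`, and equals `-1` for `q = 2`.
  · rcases eq_or_lt_of_le hq2n with h | h
    · have h2 : q = 2 := by rw [hq, ← h]; norm_num
      rw [h2]
      norm_num
      ring_nf
      norm_num
    · have h3 : 3 ≤ q := by rw [hq]; exact_mod_cast h
      have : 0 ≤ q ^ d * (q - 3) := mul_nonneg hb.le (by linarith)
      intro h0
      linarith
  · have : (2 : ℝ) ≤ N := by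
      have := mul_pos hb hq1
      linarith
    exact_mod_cast this
  · rintro ⟨W, hW⟩
    rw [card_submodule_le, card_projectivization_eq_div hW, ← hq]
    field_simp
    ring
  · rintro ⟨W, hW⟩ ⟨W', hW'⟩ hne
    simp only [← le_inf_iff]
    rw [card_submodule_le, card_projectivization_eq_div
      (finrank_inf_of_finrank_eq hV hW hW' fun h => hne (Subtype.ext h))]

/-! ### The Paley biplane -/

/-- Membership in an explicit finite set is decidable, so the block counts can be settled by
`decide`. -/
lemma paleyIncident_iff (i j : ZMod 11) :
    paleyIncident i j ↔ i - j ∈ ({1, 3, 4, 5, 9} : Finset (ZMod 11)) := by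
  unfold paleyIncident
  generalize i - j = k
  revert k
  decide

theorem matrixP11_not_isComplexAlmostHadamard (e f : Fin 11 ≃ ZMod 11) :
    rescale (toComplex (matrixP11 e f)) ∈ Matrix.unitaryGroup (Fin 11) ℂ ∧
      ¬ IsComplexAlmostHadamard (toComplex (matrixP11 e f)) := by
  refine designMatrix_not_isComplexAlmostHadamard (by norm_num) (by norm_num) (by norm_num)
    (by norm_num) (by norm_num) e f (by norm_num) (by norm_num) ?_ ?_
  · intro l
    have : Nat.card {p // paleyIncident p l} = 5 := by
      simp only [paleyIncident_iff, Nat.card_eq_fintype_card]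
      revert l
      decide
    rw [this]
    norm_num
  · intro l l' hne
    have : Nat.card {p // paleyIncident p l ∧ paleyIncident p l'} = 2 := by
      simp only [paleyIncident_iff, Nat.card_eq_fintype_card]
      revert l l'
      decide
    rw [this]
    norm_num

theorem theorem6p5 :
    (∀ N : ℕ, 2 ≤ N → N ≠ 4 →
      rescale (toComplex (matrixK N)) ∈ Matrix.unitaryGroup (Fin N) ℂ ∧
        ¬ IsComplexAlmostHadamard (toComplex (matrixK N))) ∧
    (∀ (F : Type*) [Field F] [Fintype F] (d : ℕ), 1 ≤ d →
      ∀ (N : ℕ) (e : Fin N ≃ ProjPoint F d) (f : Fin N ≃ ProjHyperplane F d),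
        rescale (toComplex (matrixI F d e f)) ∈ Matrix.unitaryGroup (Fin N) ℂ ∧
          ¬ IsComplexAlmostHadamard (toComplex (matrixI F d e f))) ∧
    (∀ e f : Fin 11 ≃ ZMod 11,
      rescale (toComplex (matrixP11 e f)) ∈ Matrix.unitaryGroup (Fin 11) ℂ ∧
        ¬ IsComplexAlmostHadamard (toComplex (matrixP11 e f))) := by
  exact ⟨fun _ h2 h4 => matrixK_not_isComplexAlmostHadamard h2 h4,
    fun F _ _ _ hd _ e f => matrixI_not_isComplexAlmostHadamard F hd e f,
    matrixP11_not_isComplexAlmostHadamard⟩
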